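/- Let $0<p<1$ and let $(\sigma_i)_{i\ge 0}$ be i.i.d. random variables on a probability space with $\mathbb P_p(\sigma_i=1)=p$ and $\mathbb P_p(\sigma_i=-1)=1-p$. Put $S_N=\sum_{i=1}^N\sigma_i\sigma_{2i}$. With $h=\frac12\log\frac{p}{1-p}$, set for $\lambda\in\mathbb R$ $$\Lambda_\pm=e^{\lambda}\Big(\cosh h\pm\sqrt{\sinh^2 h+e^{-4\lambda}}\Big),\qquad v=(e^{h/2},e^{-h/2}),\qquad w_+=(-e^{-\lambda},\,e^{h+\lambda}-\Lambda_+),\qquad e_+=\frac{w_+}{\|w_+\|},$$ with $\|\cdot\|$ the Euclidean norm, and $$\mathcal F_p(\lambda)=\log\Big([p(1-p)]^{3/4}\,|v\cdot e_+|\,\Lambda_+\Big)+\frac12\sum_{n=1}^\infty\frac1{2^n}\log\Big(1+\Big(\frac{2\cosh h}{|v\cdot e_+|^2}-1\Big)\Big(\frac{\Lambda_-}{\Lambda_+}\Big)^n\Big).$$ Then, for every $\lambda\in\mathbb R$, the series converges and $\mathcal F_p$ is the free energy of $S_N$, that is, $\mathcal F_p(\lambda)=\lim_{N\to\infty}\frac1N\log\mathbb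 E_p\big(e^{\lambda S_N}\big)$. Moreover $\mathcal F_p$ is twice continuously differentiable near $0$, $\mathcal F_p''(0)>0$, and as $N\to\infty$ the random variables $N^{-1/2}\big(S_N-\mathbb E_p(S_N)\big)$ converge weakly to a centred Gaussian random variable with variance $\mathcal F_p''(0)$. -/

import Mathlib

open MeasureTheory ProbabilityTheory Filter Topology

noncomputable section

namespace Nonconventional

/-- The nonconventional sum `S_N = ∑_{i=1}^N σ_i σ_{2i}`. -/
def sumS {Ω : Type*} (σ : ℕ → Ω → ℝ) (N : ℕ) (ω : Ω) : ℝ :=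
  ∑ i ∈ Finset.Icc 1 N, σ i ω * σ (2 * i) ω

/-- The external field `h = (1/2) log (p / (1 - p))`. -/
def field (p : ℝ) : ℝ := 1 / 2 * Real.log (p / (1 - p))

/-- The largest eigenvalue `Λ₊` of the Ising transfer matrix
`M_{α,β} = exp (t α β + (h / 2) (α + β))`. -/
def eigPlus (h t : ℝ) : ℝ :=
  Real.exp t * (Real.cosh h + √(Real.sinh h ^ 2 + Real.exp (-4 * t)))

/-- The smallest eigenvalue `Λ₋` of the Ising transfer matrix. -/
def eigMinus (h t : ℝ) : ℝ :=
  Real.exp t * (Real.cosh h - √(Real.sinh h ^ 2 + Real.exp (-4 * t)))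

/-- `|vᵀ · e₊|`, where `v = (e^{h/2}, e^{-h/2})` and `e₊ = w₊ / ‖w₊‖` is the normalized eigenvector
to `Λ₊`, with `w₊ = (-e^{-t}, e^{h + t} - Λ₊)` and `‖·‖` the Euclidean norm. -/
def overlap (h t : ℝ) : ℝ :=
  |Real.exp (h / 2) * (-Real.exp (-t)) + Real.exp (-(h / 2)) * (Real.exp (h + t) - eigPlus h t)| /
    √((-Real.exp (-t)) ^ 2 + (Real.exp (h + t) - eigPlus h t) ^ 2)

/-- The `n`-th term (used for `n ≥ 1`) of the series in the free energy,
`2⁻ⁿ log (1 + (2 cosh h / |vᵀ · e₊|² - 1) (Λ₋ / Λ₊)ⁿ)`. -/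
def seriesTerm (h t : ℝ) (n : ℕ) : ℝ :=
  1 / 2 ^ n * Real.log
    (1 + (2 * Real.cosh h / overlap h t ^ 2 - 1) * (eigMinus h t / eigPlus h t) ^ n)

/-- The free energy
`F_p(t) = log ([p (1 - p)]^{3/4} |vᵀ · e₊| Λ₊) + (1/2) ∑_{n ≥ 1} seriesTerm n`. -/
def freeEnergy (p t : ℝ) : ℝ :=
  Real.log ((p * (1 - p)) ^ (3 / 4 : ℝ) * overlap (field p) t * eigPlus (field p) t) +
    1 / 2 * ∑' n : ℕ, seriesTerm (field p) t (n + 1)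

end Nonconventional

end

/-!
The bonds `{i, 2 i}` of `S_N` split into chains `k, 2 k, 4 k, …`, one for each odd `k ≤ N`, so `S_N`
is a sum of independent one-dimensional nearest-neighbour Ising energies `X_m`, where `m` is the
number of bonds of the chain (`sumS_eq_sum_chainSum`, `chains_iIndepFun_and_hasLaw`). Among the
first `N` integers the chains with exactly `m ≥ 1` bonds have density `2⁻⁽ᵐ⁺¹⁾`; summation by layers
and dominated convergence turn this into a limit theorem for averages, over the chains, of any
function of `m` of polynomial growth (`tendsto_average_chainLength`).

*Free energy.* The logarithm of `E[e^{t S_N}]` is the sum over the chains of the cumulant generating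
functions of the `X_m`, hence `N⁻¹ log E[e^{t S_N}]` tends to `∑_{m ≥ 1} 2⁻⁽ᵐ⁺¹⁾ cgf X_m (t)`. The
transfer matrix gives `E[e^{t X_m}] = s^{m+1} vᵀ Mᵐ v` with `s = √(p (1 - p))`; here this closed form
is derived from its two-term recurrence (`mgf_chainSum_succ`, `eq_of_recurrence`). Taking logarithms
and summing over `m` identifies that series with the free energy `freeEnergy p t` and yields
the convergence of the series in it (`summable_seriesTerm_and_freeEnergy_eq`).

*Smoothness.* As `|X_m| ≤ m`, the first and second derivatives of `cgf X_m`, which are the mean and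
the variance under a tilted measure, are at most `m` and `m ^ 2`. The series can be differentiated
twice term by term, and the second derivative at `0` is `∑_{m ≥ 1} 2⁻⁽ᵐ⁺¹⁾ Var X_m`, which is
positive because `Var X_1 = 1 - (2 p - 1) ^ 4`
(`contDiff_freeEnergy_and_iteratedDeriv_two`, `iteratedDeriv_two_freeEnergy_pos`).

*Central limit theorem.* The characteristic function of the centred and rescaled sum is a product
over the chains. Each factor is within `O(m ^ 3 N^{-3/2} + m ^ 4 N⁻²)` of that of a Gaussian variable
with variance `Var X_m / N`, so the averaging theorem both removes the error and computes the limit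
(`tendsto_prod_chainCharFun`), and Lévy's convergence theorem concludes.
-/

namespace Nonconventional

/-! ### Decomposition of the sum along geometric chains -/

/-- The one-dimensional Ising energy `∑_{j < m} x_j x_{j+1}` of the first `m` bonds of the
configuration `x`. -/
def chainSum (m : ℕ) (x : ℕ → ℝ) : ℝ := ∑ j ∈ Finset.range m, x j * x (j + 1)

/-- The number of `j` with `2 ^ j * (2 * a + 1) ≤ N`: the number of bonds of `S_N` on the chain
that starts at the odd number `2 * a + 1`. It is `0` when `N < 2 * a + 1`. -/
def chainLength (N a : ℕ) : ℕ := (N / (2 * a + 1)).size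

lemma lt_chainLength {N a j : ℕ} : j < chainLength N a ↔ 2 ^ j * (2 * a + 1) ≤ N := by
  rw [chainLength, Nat.lt_size, Nat.le_div_iff_mul_le (by omega)]

lemma two_pow_mul_odd_injective :
    Function.Injective (fun q : ℕ × ℕ => 2 ^ q.2 * (2 * q.1 + 1)) := by
  have aux : ∀ {a j b k : ℕ}, j ≤ k → 2 ^ j * (2 * a + 1) = 2 ^ k * (2 * b + 1) →
      a = b ∧ j = k := by
    intro a j b k hjk h
    obtain ⟨d, rfl⟩ := Nat.exists_eq_add_of_le hjk
    rw [pow_add, mul_assoc, Nat.mul_right_inj (by positivity)] at h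
    rcases d with _ | d
    · exact ⟨by omega, rfl⟩
    · rw [pow_succ', mul_assoc] at h
      omega
  rintro ⟨a, j⟩ ⟨b, k⟩ h
  rcases le_total j k with hjk | hjk
  · obtain ⟨rfl, rfl⟩ := aux hjk h
    rfl
  · obtain ⟨rfl, rfl⟩ := aux hjk h.symm
    rfl

/-- The bonds `{i, 2 i}` split into chains, each of them following `k, 2 k, 4 k, …` from an odd
starting point `k = 2 a + 1`. -/
lemma sumS_eq_sum_chainSum {Ω : Type*} (σ : ℕ → Ω → ℝ) (N : ℕ) (ω : Ω) :
    sumS σ N ω = ∑ a ∈ Finset.range N,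
      chainSum (chainLength N a) (fun j => σ (2 ^ j * (2 * a + 1)) ω) := by
  simp only [chainSum]
  rw [Finset.sum_sigma', sumS]
  symm
  refine Finset.sum_nbij (fun q => 2 ^ q.2 * (2 * q.1 + 1)) ?_ ?_ ?_ ?_
  · rintro ⟨a, j⟩ h
    simp only [Finset.mem_sigma, Finset.mem_range, lt_chainLength] at h
    exact Finset.mem_Icc.2 ⟨Nat.mul_pos (by positivity) (by omega), h.2⟩
  · rintro ⟨a, j⟩ - ⟨b, k⟩ - h
    have := @two_pow_mul_odd_injective (a, j) (b, k) h
    simp only [Prod.mk.injEq] at this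
    obtain ⟨rfl, rfl⟩ := this
    rfl
  · intro i hi
    have hi' := Finset.mem_Icc.1 hi
    obtain ⟨j, k, ⟨a, rfl⟩, rfl⟩ := Nat.exists_eq_two_pow_mul_odd (n := i) (by omega)
    have h1 : 2 * a + 1 ≤ 2 ^ j * (2 * a + 1) := Nat.le_mul_of_pos_left _ (by positivity)
    exact ⟨⟨a, j⟩, by simpa [lt_chainLength] using ⟨by omega, hi'.2⟩, rfl⟩
  · rintro ⟨a, j⟩ -
    rw [pow_succ']
    simp only [mul_assoc]

/-! ### Averages over the chains -/

lemma card_chainLength_gt (N j : ℕ) :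
    ((Finset.range N).filter (fun a => j < chainLength N a)).card = (N / 2 ^ j + 1) / 2 := by
  have : (Finset.range N).filter (fun a => j < chainLength N a)
      = Finset.range ((N / 2 ^ j + 1) / 2) := by
    ext a
    have h1 : N / 2 ^ j ≤ N := Nat.div_le_self _ _
    have h2 : 2 ^ j * (2 * a + 1) ≤ N ↔ 2 * a + 1 ≤ N / 2 ^ j := by
      rw [Nat.le_div_iff_mul_le (by positivity), mul_comm]
    simp only [Finset.mem_filter, Finset.mem_range, lt_chainLength, h2]
    omega
  rw [this, Finset.card_range]

/-- Summation by layers over the chain lengths. -/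
lemma sum_chainLength {f : ℕ → ℝ} (h0 : f 0 = 0) (N : ℕ) :
    ∑ a ∈ Finset.range N, f (chainLength N a) =
      ∑' j : ℕ, (f (j + 1) - f j) * (((N / 2 ^ j + 1) / 2 : ℕ) : ℝ) := by
  have hvan : ∀ j ∉ Finset.range N,
      (f (j + 1) - f j) * (((N / 2 ^ j + 1) / 2 : ℕ) : ℝ) = 0 := by
    intro j hj
    have : N < 2 ^ j := lt_of_le_of_lt (by simpa using hj) Nat.lt_two_pow_self
    simp [Nat.div_eq_of_lt this]
  rw [tsum_eq_sum hvan]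
  have hlen : ∀ a, chainLength N a ≤ N := by
    intro a
    by_contra h
    have h1 := lt_chainLength.1 (not_le.1 h)
    have h2 : N < 2 ^ N := Nat.lt_two_pow_self
    have h3 : 2 ^ N ≤ 2 ^ N * (2 * a + 1) := Nat.le_mul_of_pos_right _ (by omega)
    omega
  calc ∑ a ∈ Finset.range N, f (chainLength N a)
      = ∑ a ∈ Finset.range N, ∑ j ∈ Finset.range N,
          if j < chainLength N a then f (j + 1) - f j else 0 := by
        refine Finset.sum_congr rfl fun a _ => ?_
        rw [← Finset.sum_filter]
        have : (Finset.range N).filter (fun j => j < chainLength N a)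
            = Finset.range (chainLength N a) := by
          ext j
          have := hlen a
          simp only [Finset.mem_filter, Finset.mem_range]
          omega
        rw [this, Finset.sum_range_sub, h0, sub_zero]
    _ = _ := by
        rw [Finset.sum_comm]
        refine Finset.sum_congr rfl fun j _ => ?_
        rw [← Finset.sum_filter, Finset.sum_const, card_chainLength_gt, nsmul_eq_mul, mul_comm]

lemma tendsto_card_chainLength_div (j : ℕ) :
    Tendsto (fun N : ℕ => (((N / 2 ^ j + 1) / 2 : ℕ) : ℝ) / N) atTop (𝓝 (1 / 2 ^ (j + 1))) := by
  rw [tendsto_iff_dist_tendsto_zero]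
  refine squeeze_zero' (Eventually.of_forall fun _ => dist_nonneg) ?_
    tendsto_one_div_atTop_nhds_zero_nat
  filter_upwards [eventually_gt_atTop 0] with N hN
  have hN' : (0 : ℝ) < N := by exact_mod_cast hN
  have hp : 0 < 2 ^ (j + 1) := by positivity
  -- `q` is `⌊N / 2 ^ (j + 1)⌋` or one more, so `q / N` is within `1 / N` of the limit
  set q := (N / 2 ^ j + 1) / 2 with hq
  have hr : N / 2 ^ (j + 1) = N / 2 ^ j / 2 := by rw [pow_succ, Nat.div_div_eq_div_mul]
  have h1 : N / 2 ^ (j + 1) ≤ q := by omega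
  have h2 : q ≤ N / 2 ^ (j + 1) + 1 := by omega
  have h3 : N < 2 ^ (j + 1) * (q + 1) := by
    have := Nat.lt_mul_div_succ N hp
    exact this.trans_le (Nat.mul_le_mul_left _ (by omega))
  have h4 : 2 ^ (j + 1) * q ≤ N + 2 ^ (j + 1) := by
    calc 2 ^ (j + 1) * q ≤ 2 ^ (j + 1) * (N / 2 ^ (j + 1) + 1) := Nat.mul_le_mul_left _ h2
      _ ≤ N + 2 ^ (j + 1) := by
        rw [mul_add, mul_one]
        exact Nat.add_le_add_right (Nat.mul_div_le _ _) _
  have h3' : (N : ℝ) < 2 ^ (j + 1) * (q + 1) := by exact_mod_cast h3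
  have h4' : (2 : ℝ) ^ (j + 1) * q ≤ N + 2 ^ (j + 1) := by exact_mod_cast h4
  have hp' : (0 : ℝ) < 2 ^ (j + 1) := by positivity
  rw [Real.dist_eq, show (q : ℝ) / N - 1 / 2 ^ (j + 1) = (2 ^ (j + 1) * q - N) / 2 ^ (j + 1) / N by
    field_simp, abs_div, abs_of_pos hN']
  gcongr
  rw [abs_div, abs_of_pos hp', div_le_one hp', abs_le]
  constructor <;> linarith

lemma summable_pow_div_two_pow (C : ℝ) (d : ℕ) :
    Summable (fun j : ℕ => C * ((j : ℝ) + 1) ^ d / 2 ^ (j + 1)) := by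
  have h := (summable_nat_add_iff 1).2
    (summable_pow_mul_geometric_of_norm_lt_one (R := ℝ) d (r := 1 / 2) (by norm_num))
  refine (h.mul_left C).congr fun j => ?_
  push_cast
  rw [one_div, inv_pow]
  ring

lemma summable_div_two_pow_of_le {f : ℕ → ℝ} {C : ℝ} {d : ℕ} (hf : ∀ m, |f m| ≤ C * (m : ℝ) ^ d) :
    Summable (fun m : ℕ => f (m + 1) / 2 ^ (m + 2)) := by
  refine Summable.of_norm_bounded (summable_pow_div_two_pow C d) fun m => ?_
  rw [Real.norm_eq_abs, abs_div, abs_of_pos (by positivity : (0 : ℝ) < 2 ^ (m + 2))]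
  have h := hf (m + 1)
  push_cast at h
  calc |f (m + 1)| / 2 ^ (m + 2) ≤ |f (m + 1)| / 2 ^ (m + 1) := by
        gcongr
        · norm_num
        · omega
    _ ≤ _ := by gcongr

/-- Chains with exactly `m` bonds have asymptotic density `2⁻⁽ᵐ⁺¹⁾`, and averages of functions of
polynomial growth over the chains converge accordingly. -/
lemma tendsto_average_chainLength {f : ℕ → ℝ} {C : ℝ} {d : ℕ} (h0 : f 0 = 0)
    (hf : ∀ m, |f m| ≤ C * (m : ℝ) ^ d) :
    Tendsto (fun N : ℕ => 1 / (N : ℝ) * ∑ a ∈ Finset.range N, f (chainLength N a)) atTop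
      (𝓝 (∑' m : ℕ, f (m + 1) / 2 ^ (m + 2))) := by
  have hC : 0 ≤ C := by simpa using (abs_nonneg _).trans (hf 1)
  have hs := summable_div_two_pow_of_le hf
  -- summation by parts, with `f 0 = 0`
  have hlim : ∑' m : ℕ, f (m + 1) / 2 ^ (m + 2) =
      ∑' j : ℕ, (f (j + 1) - f j) * (1 / 2 ^ (j + 1)) := by
    have e1 : (fun j : ℕ => f (j + 1) / 2 ^ (j + 1)) = fun j => 2 * (f (j + 1) / 2 ^ (j + 2)) := by
      funext j
      rw [pow_succ _ (j + 1)]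
      field_simp
    have hs1 : Summable (fun j : ℕ => f (j + 1) / 2 ^ (j + 1)) := by
      have := hs.mul_left 2
      rw [← e1] at this
      exact this
    have hs2 : Summable (fun j : ℕ => f j / 2 ^ (j + 1)) := (summable_nat_add_iff 1).1 hs
    have e2 : ∑' j : ℕ, f j / 2 ^ (j + 1) = ∑' j : ℕ, f (j + 1) / 2 ^ (j + 2) := by
      rw [hs2.tsum_eq_zero_add, h0]
      simp
    have e3 : ∑' j : ℕ, f (j + 1) / 2 ^ (j + 1) = 2 * ∑' j : ℕ, f (j + 1) / 2 ^ (j + 2) := by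
      rw [← tsum_mul_left]
      exact congrArg tsum e1
    have e4 := hs1.tsum_sub hs2
    rw [e2, e3] at e4
    rw [show (fun j : ℕ => (f (j + 1) - f j) * (1 / (2 : ℝ) ^ (j + 1)))
      = fun j => f (j + 1) / 2 ^ (j + 1) - f j / 2 ^ (j + 1) from by funext j; ring, e4]
    ring
  rw [hlim]
  have hrw : ∀ N : ℕ, 1 / (N : ℝ) * ∑ a ∈ Finset.range N, f (chainLength N a) =
      ∑' j : ℕ, (f (j + 1) - f j) * ((((N / 2 ^ j + 1) / 2 : ℕ) : ℝ) / N) := by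
    intro N
    rw [sum_chainLength h0, ← tsum_mul_left]
    refine tsum_congr fun j => ?_
    ring
  simp_rw [hrw]
  refine tendsto_tsum_of_dominated_convergence (summable_pow_div_two_pow (4 * C) d)
    (fun j => (tendsto_card_chainLength_div j).const_mul _) ?_
  filter_upwards [eventually_gt_atTop 0] with N hN j
  have hN' : (0 : ℝ) < N := by exact_mod_cast hN
  have hfj : |f (j + 1) - f j| ≤ 2 * C * ((j : ℝ) + 1) ^ d := by
    have h1 := hf (j + 1)
    have h2 := hf j
    have h3 : (j : ℝ) ^ d ≤ ((j : ℝ) + 1) ^ d := by gcongr; linarith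
    push_cast at h1
    calc |f (j + 1) - f j| ≤ |f (j + 1)| + |f j| := abs_sub _ _
      _ ≤ C * ((j : ℝ) + 1) ^ d + C * ((j : ℝ) + 1) ^ d := by gcongr; exact h2.trans (by gcongr)
      _ = _ := by ring
  have hq : (((N / 2 ^ j + 1) / 2 : ℕ) : ℝ) / N ≤ 1 / 2 ^ j := by
    rw [div_le_div_iff₀ hN' (by positivity), one_mul]
    have hhalf : ∀ n : ℕ, (n + 1) / 2 ≤ n := fun n => by omega
    have : (N / 2 ^ j + 1) / 2 * 2 ^ j ≤ N :=
      (Nat.mul_le_mul_right _ (hhalf _)).trans (Nat.div_mul_le_self N (2 ^ j))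
    exact_mod_cast this
  rw [Real.norm_eq_abs, abs_mul, abs_of_nonneg (a := _ / (N : ℝ)) (by positivity)]
  calc |f (j + 1) - f j| * ((((N / 2 ^ j + 1) / 2 : ℕ) : ℝ) / N)
      ≤ 2 * C * ((j : ℝ) + 1) ^ d * (1 / 2 ^ j) := by gcongr
    _ = 4 * C * ((j : ℝ) + 1) ^ d / 2 ^ (j + 1) := by
      rw [pow_succ]
      field_simp
      ring

/-! ### Cumulant generating functions of bounded random variables -/

section Bounded

variable {α : Type*} [MeasurableSpace α] {ν : Measure α} [IsProbabilityMeasure ν]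
  {X : α → ℝ} {B : ℝ}

lemma integrable_exp_mul_of_abs_le (hX : AEMeasurable X ν) (hB : ∀ᵐ x ∂ν, |X x| ≤ B) (t : ℝ) :
    Integrable (fun x => Real.exp (t * X x)) ν :=
  integrable_exp_mul_of_mem_Icc (a := -B) (b := B) hX (by
    filter_upwards [hB] with x hx using abs_le.1 hx)

lemma mem_interior_integrableExpSet (hX : AEMeasurable X ν) (hB : ∀ᵐ x ∂ν, |X x| ≤ B) (t : ℝ) :
    t ∈ interior (integrableExpSet X ν) := by
  have : integrableExpSet X ν = Set.univ :=
    Set.eq_univ_of_forall fun t => integrable_exp_mul_of_abs_le hX hB t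
  simp [this]

lemma abs_cgf_le (hX : AEMeasurable X ν) (hB : ∀ᵐ x ∂ν, |X x| ≤ B) (t : ℝ) :
    |cgf X ν t| ≤ |t| * B := by
  have hint := integrable_exp_mul_of_abs_le hX hB t
  have hpos := mgf_pos hint
  have hb : ∀ᵐ x ∂ν, |t * X x| ≤ |t| * B := by
    filter_upwards [hB] with x hx
    rw [abs_mul]
    gcongr
  rw [cgf, abs_le]
  constructor
  · rw [Real.le_log_iff_exp_le hpos]
    have := integral_mono_ae (integrable_const (Real.exp (-(|t| * B)))) hint (by
      filter_upwards [hb] with x hx using Real.exp_le_exp.2 (abs_le.1 hx).1)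
    simpa [mgf] using this
  · rw [Real.log_le_iff_le_exp hpos]
    have := integral_mono_ae hint (integrable_const (Real.exp (|t| * B))) (by
      filter_upwards [hb] with x hx using Real.exp_le_exp.2 (abs_le.1 hx).2)
    simpa [mgf] using this

lemma contDiff_cgf (hX : AEMeasurable X ν) (hB : ∀ᵐ x ∂ν, |X x| ≤ B) {n : WithTop ℕ∞} :
    ContDiff ℝ n (cgf X ν) :=
  contDiff_iff_contDiffAt.2 fun t =>
    (analyticAt_cgf (mem_interior_integrableExpSet hX hB t)).contDiffAt

/-- `cgf'(t)` is the mean of `X` under the tilted measure. -/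
lemma abs_deriv_cgf_le (hX : AEMeasurable X ν) (hB : ∀ᵐ x ∂ν, |X x| ≤ B) (t : ℝ) :
    |deriv (cgf X ν) t| ≤ B := by
  have := isProbabilityMeasure_tilted (integrable_exp_mul_of_abs_le hX hB t)
  rw [← integral_tilted_mul_self (mem_interior_integrableExpSet hX hB t)]
  have h := norm_integral_le_of_norm_le_const (μ := ν.tilted fun x => t * X x) (f := X) (C := B)
    ((tilted_absolutelyContinuous ν _).ae_le hB)
  simpa using h

lemma variance_le_of_abs_le (hX : AEMeasurable X ν) (hB : ∀ᵐ x ∂ν, |X x| ≤ B) :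
    Var[X; ν] ≤ B ^ 2 := by
  have := variance_le_sq_of_bounded (a := -B) (b := B)
    (by filter_upwards [hB] with x hx using abs_le.1 hx) hX
  refine this.trans (le_of_eq ?_)
  ring

/-- `cgf''(t)` is the variance of `X` under the tilted measure. -/
lemma abs_iteratedDeriv_two_cgf_le (hX : AEMeasurable X ν) (hB : ∀ᵐ x ∂ν, |X x| ≤ B) (t : ℝ) :
    |iteratedDeriv 2 (cgf X ν) t| ≤ B ^ 2 := by
  have := isProbabilityMeasure_tilted (integrable_exp_mul_of_abs_le hX hB t)
  rw [← variance_tilted_mul (mem_interior_integrableExpSet hX hB t), abs_of_nonneg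
    (variance_nonneg _ _)]
  exact variance_le_of_abs_le (hX.mono_ac (tilted_absolutelyContinuous ν _))
    ((tilted_absolutelyContinuous ν _).ae_le hB)

lemma iteratedDeriv_two_cgf_zero (hX : AEMeasurable X ν) (hB : ∀ᵐ x ∂ν, |X x| ≤ B) :
    iteratedDeriv 2 (cgf X ν) 0 = Var[X; ν] := by
  rw [← variance_tilted_mul (mem_interior_integrableExpSet hX hB 0)]
  simp

end Bounded

/-- Termwise differentiation for series whose sum need not be bounded: only the first and second
derivatives are uniformly dominated. -/
lemma contDiff_two_tsum {g : ℕ → ℝ → ℝ} {u v : ℕ → ℝ} (hg : ∀ n, ContDiff ℝ 2 (g n))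
    (hu : Summable u) (hv : Summable v) (hgu : ∀ n t, |deriv (g n) t| ≤ u n)
    (hgv : ∀ n t, |iteratedDeriv 2 (g n) t| ≤ v n) (h0 : Summable fun n => g n 0) :
    ContDiff ℝ 2 (fun t => ∑' n, g n t) ∧
      ∀ t, iteratedDeriv 2 (fun t => ∑' n, g n t) t = ∑' n, iteratedDeriv 2 (g n) t := by
  have hd : ∀ n, Differentiable ℝ (g n) := fun n => (hg n).differentiable (by norm_num)
  have hg' : ∀ n, ContDiff ℝ 1 (deriv (g n)) := fun n =>
    (contDiff_succ_iff_deriv (n := 1).1 (by simpa [one_add_one_eq_two] using hg n)).2.2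
  have hderiv : deriv (fun t => ∑' n, g n t) = fun t => ∑' n, deriv (g n) t :=
    deriv_tsum hu hd hgu h0
  have hdd : ∀ n, deriv (deriv (g n)) = iteratedDeriv 2 (g n) := fun n => by
    rw [iteratedDeriv_succ, iteratedDeriv_one]
  have hderiv2 : deriv (fun t => ∑' n, deriv (g n) t) = fun t => ∑' n, iteratedDeriv 2 (g n) t := by
    rw [deriv_tsum (y₀ := 0) hv (fun n => (hg' n).differentiable (by norm_num))
      (fun n t => by rw [hdd]; exact hgv n t)
      (Summable.of_norm_bounded hu fun n => hgu n 0)]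
    simp_rw [hdd]
  refine ⟨?_, fun t => ?_⟩
  · rw [show (2 : WithTop ℕ∞) = 1 + 1 from one_add_one_eq_two.symm, contDiff_succ_iff_deriv]
    refine ⟨fun t => (hasDerivAt_tsum hu (fun n y => (hd n y).hasDerivAt) hgu h0 t).differentiableAt,
      by simp, ?_⟩
    rw [hderiv, show (1 : WithTop ℕ∞) = 0 + 1 from (zero_add 1).symm, contDiff_succ_iff_deriv]
    refine ⟨fun t => (hasDerivAt_tsum (y₀ := 0) hv
      (fun n y => ((hg' n).differentiable (by norm_num) y).hasDerivAt)
      (fun n t => by rw [hdd]; exact hgv n t)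
      (Summable.of_norm_bounded hu fun n => hgu n 0) t).differentiableAt, by simp, ?_⟩
    rw [hderiv2, contDiff_zero]
    exact continuous_tsum (fun n => (hg n).continuous_iteratedDeriv 2 le_rfl) hv hgv
  · rw [iteratedDeriv_succ, iteratedDeriv_one, hderiv, hderiv2]

/-! ### Spectral data of the transfer matrix -/

section Spectral

variable (h t : ℝ)

lemma abs_sinh_lt_sqrt : |Real.sinh h| < √(Real.sinh h ^ 2 + Real.exp (-4 * t)) := by
  rw [← Real.sqrt_sq_eq_abs]
  exact Real.sqrt_lt_sqrt (sq_nonneg _) (by linarith [Real.exp_pos (-4 * t)])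

lemma eigPlus_pos : 0 < eigPlus h t := by
  have := Real.cosh_pos h
  unfold eigPlus
  positivity

lemma eigPlus_sub_pos : 0 < eigPlus h t - Real.exp (h + t) := by
  have h1 := (le_abs_self _).trans_lt (abs_sinh_lt_sqrt h t)
  have h2 : eigPlus h t - Real.exp (h + t) =
      Real.exp t * (√(Real.sinh h ^ 2 + Real.exp (-4 * t)) - Real.sinh h) := by
    rw [eigPlus, Real.exp_add, ← Real.cosh_add_sinh h]
    ring
  rw [h2]
  exact mul_pos (Real.exp_pos _) (sub_pos.2 h1)

lemma eigPlus_add_eigMinus : eigPlus h t + eigMinus h t = Real.exp t * (2 * Real.cosh h) := by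
  rw [eigPlus, eigMinus]
  ring

lemma eigPlus_mul_eigMinus :
    eigPlus h t * eigMinus h t = Real.exp t ^ 2 - Real.exp (-t) ^ 2 := by
  have hR := Real.sq_sqrt (show 0 ≤ Real.sinh h ^ 2 + Real.exp (-4 * t) by positivity)
  have h4 : Real.exp t ^ 2 * Real.exp (-4 * t) = Real.exp (-t) ^ 2 := by
    rw [← Real.exp_nat_mul, ← Real.exp_nat_mul, ← Real.exp_add]
    congr 1
    push_cast
    ring
  calc eigPlus h t * eigMinus h t
      = Real.exp t ^ 2 * (Real.cosh h ^ 2 - √(Real.sinh h ^ 2 + Real.exp (-4 * t)) ^ 2) := by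
        rw [eigPlus, eigMinus]
        ring
    _ = _ := by
        rw [hR, Real.cosh_sq, ← h4]
        ring

lemma overlap_pos : 0 < overlap h t := by
  have hw := eigPlus_sub_pos h t
  unfold overlap
  refine div_pos (abs_pos.2 (ne_of_lt ?_)) (Real.sqrt_pos.2
    (add_pos_of_pos_of_nonneg (by rw [neg_sq]; positivity) (sq_nonneg _)))
  have h1 : 0 < Real.exp (h / 2) * Real.exp (-t) := by positivity
  have h2 : 0 < Real.exp (-(h / 2)) * (eigPlus h t - Real.exp (h + t)) :=
    mul_pos (Real.exp_pos _) hw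
  linarith

/-- The identity `vᵀ M v = Λ₊ |vᵀ e₊|² + Λ₋ (|v|² - |vᵀ e₊|²)`, with `vᵀ M v` computed from the
entries of the transfer matrix. -/
lemma overlap_sq_mul :
    overlap h t ^ 2 * eigPlus h t + (2 * Real.cosh h - overlap h t ^ 2) * eigMinus h t =
      Real.exp t * (Real.exp h ^ 2 + Real.exp (-h) ^ 2) + 2 * Real.exp (-t) := by
  set w := eigPlus h t - Real.exp (h + t) with hw_def
  have hw : 0 < w := eigPlus_sub_pos h t
  have hL : eigPlus h t = w + Real.exp t * Real.exp h := by
    rw [hw_def, Real.exp_add]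
    ring
  have hc : 2 * Real.cosh h = Real.exp h + Real.exp (-h) := by
    rw [Real.cosh_eq]
    ring
  have hHH : Real.exp h * Real.exp (-h) = 1 := by rw [← Real.exp_add]; simp
  have hsum := eigPlus_add_eigMinus h t
  have hM : eigMinus h t = Real.exp t * Real.exp (-h) - w := by
    rw [hL, hc] at hsum
    linarith
  have hquad : w * (w + Real.exp t * (Real.exp h - Real.exp (-h))) = Real.exp (-t) ^ 2 := by
    have := eigPlus_mul_eigMinus h t
    rw [hL, hM] at this
    linear_combination -this + Real.exp t ^ 2 * hHH
  have hE2 : Real.exp (h / 2) ^ 2 = Real.exp h := by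
    rw [← Real.exp_nat_mul]; congr 1; push_cast; ring
  have hE2' : Real.exp (-(h / 2)) ^ 2 = Real.exp (-h) := by
    rw [← Real.exp_nat_mul]; congr 1; push_cast; ring
  have hEE : Real.exp (h / 2) * Real.exp (-(h / 2)) = 1 := by rw [← Real.exp_add]; simp
  have hov : overlap h t ^ 2 * (Real.exp (-t) ^ 2 + w ^ 2) =
      Real.exp h * Real.exp (-t) ^ 2 + 2 * Real.exp (-t) * w + Real.exp (-h) * w ^ 2 := by
    have hpos : 0 < Real.exp (-t) ^ 2 + w ^ 2 := by positivity
    have : Real.exp (h + t) - eigPlus h t = -w := by rw [hw_def]; ring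
    rw [overlap, this, div_pow, sq_abs, Real.sq_sqrt (by positivity), neg_sq, neg_sq,
      div_mul_cancel₀ _ hpos.ne']
    linear_combination Real.exp (-t) ^ 2 * hE2 + w ^ 2 * hE2' + 2 * Real.exp (-t) * w * hEE
  -- `Λ₊ - Λ₋` times `w` is the squared norm of `w₊`
  have hden : w * (eigPlus h t - eigMinus h t) = Real.exp (-t) ^ 2 + w ^ 2 := by
    rw [hL, hM]
    linear_combination hquad
  refine mul_left_cancel₀ hw.ne' ?_
  rw [hc]
  rw [← hden] at hov
  rw [hL, hM] at hov ⊢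
  generalize Real.exp t = T at *
  generalize Real.exp (-t) = U at *
  generalize Real.exp h = H at *
  generalize Real.exp (-h) = K at *
  linear_combination hov - H * hquad

/-- The closed form of `vᵀ Mᵐ v`, up to powers of `s`, from its two-term recurrence. -/
lemma eq_of_recurrence {s : ℝ} (hs : s * (2 * Real.cosh h) = 1) {Z : ℕ → ℝ} (h0 : Z 0 = 1)
    (h1 : Z 1 = s ^ 2 * (Real.exp t * (Real.exp h ^ 2 + Real.exp (-h) ^ 2) + 2 * Real.exp (-t)))
    (h2 : ∀ m, Z (m + 2) =
      s * (eigPlus h t + eigMinus h t) * Z (m + 1) - s ^ 2 * (eigPlus h t * eigMinus h t) * Z m)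
    (m : ℕ) :
    Z m = s ^ (m + 1) * (overlap h t ^ 2 * eigPlus h t ^ m +
      (2 * Real.cosh h - overlap h t ^ 2) * eigMinus h t ^ m) := by
  induction m using Nat.twoStepInduction with
  | zero =>
    rw [h0]
    linear_combination -hs
  | one =>
    rw [h1, ← overlap_sq_mul]
    ring
  | more m ih1 ih2 =>
    rw [h2, ih1, ih2]
    ring

/-- The logarithm of the closed form, with the constants of the free energy series split off. -/
lemma log_eq_of_pos {s z : ℝ} {m : ℕ} (hs : 0 < s) (hz : 0 < z)
    (hzm : z = s ^ (m + 1) * (overlap h t ^ 2 * eigPlus h t ^ m +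
      (2 * Real.cosh h - overlap h t ^ 2) * eigMinus h t ^ m)) :
    Real.log z = (m + 1) * Real.log s + 2 * Real.log (overlap h t) + m * Real.log (eigPlus h t) +
      2 ^ m * seriesTerm h t m := by
  have hov := overlap_pos h t
  have hL := eigPlus_pos h t
  have hfac : z = s ^ (m + 1) * overlap h t ^ 2 * eigPlus h t ^ m *
      (1 + (2 * Real.cosh h / overlap h t ^ 2 - 1) * (eigMinus h t / eigPlus h t) ^ m) := by
    rw [hzm, div_pow]
    field_simp
  have hpos : 0 < 1 + (2 * Real.cosh h / overlap h t ^ 2 - 1) * (eigMinus h t / eigPlus h t) ^ m := by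
    rw [hfac] at hz
    exact pos_of_mul_pos_right hz (by positivity)
  rw [hfac, Real.log_mul (by positivity) hpos.ne', Real.log_mul (by positivity) (by positivity),
    Real.log_mul (by positivity) (by positivity), Real.log_pow, Real.log_pow, Real.log_pow,
    seriesTerm]
  push_cast
  field_simp

end Spectral

/-! ### The law of a single chain -/

/-- The law of an infinite sequence of independent spins, equal to `1` with probability `p` and to
`-1` with probability `1 - p`. -/
noncomputable def configLaw (p : unitInterval) : Measure (ℕ → ℝ) :=
  Measure.infinitePi fun _ => bernoulliMeasure (1 : ℝ) (-1) p

instance (p : unitInterval) : IsProbabilityMeasure (configLaw p) := by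
  unfold configLaw
  infer_instance

lemma measurable_chainSum (m : ℕ) : Measurable (chainSum m) := by
  unfold chainSum
  fun_prop

section ConfigLaw

variable (p : unitInterval)

lemma hasLaw_coord (i : ℕ) :
    HasLaw (fun x : ℕ → ℝ => x i) (bernoulliMeasure (1 : ℝ) (-1) p) (configLaw p) :=
  (measurePreserving_eval_infinitePi (fun _ : ℕ => bernoulliMeasure (1 : ℝ) (-1) p) i).hasLaw

lemma ae_coord : ∀ᵐ x ∂configLaw p, ∀ i, x i = 1 ∨ x i = -1 := by
  refine ae_all_iff.2 fun i => ?_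
  have hm : MeasurableSet {y : ℝ | y = 1 ∨ y = -1} :=
    (measurableSet_singleton 1).union (measurableSet_singleton (-1))
  have h : ∀ᵐ y ∂bernoulliMeasure (1 : ℝ) (-1) p, y = 1 ∨ y = -1 := by
    rw [ae_iff]
    exact bernoulliMeasure_apply_of_notMem_of_notMem p hm.compl (by simp) (by simp)
  exact ((hasLaw_coord p i).ae_iff (measurableSet_setOfPred.1 hm)).2 h

lemma integral_coord (i : ℕ) : ∫ x, x i ∂configLaw p = 2 * (p : ℝ) - 1 := by
  rw [(hasLaw_coord p i).integral_eq, integral_bernoulliMeasure]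
  simp only [smul_eq_mul]
  ring

lemma ae_abs_chainSum_le (m : ℕ) : ∀ᵐ x ∂configLaw p, |chainSum m x| ≤ m := by
  filter_upwards [ae_coord p] with x hx
  calc |chainSum m x| ≤ ∑ j ∈ Finset.range m, |x j * x (j + 1)| := Finset.abs_sum_le_sum_abs _ _
    _ ≤ ∑ j ∈ Finset.range m, 1 := by
        refine Finset.sum_le_sum fun j _ => ?_
        rcases hx j with h | h <;> rcases hx (j + 1) with h' | h' <;> simp [h, h']
    _ = m := by simp

lemma iIndepFun_coord : iIndepFun (fun i (x : ℕ → ℝ) => x i) (configLaw p) :=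
  iIndepFun_infinitePi (X := fun (_ : ℕ) (y : ℝ) => y) (fun _ => measurable_id)

/-- A function of the coordinates `0, …, m` is independent of the coordinate `m + 1`. -/
lemma integral_mul_coord {F : (ℕ → ℝ) → ℝ} {m : ℕ} (hF : Measurable F)
    (hdep : DependsOn F (Set.Iic m)) :
    ∫ x, F x * x (m + 1) ∂configLaw p = (∫ x, F x ∂configLaw p) * (2 * (p : ℝ) - 1) := by
  classical
  let ext : (Finset.range (m + 1) → ℝ) → ℕ → ℝ := fun y i =>
    if hi : i ∈ Finset.range (m + 1) then y ⟨i, hi⟩ else 0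
  have hext : Measurable ext := by
    refine measurable_pi_iff.2 fun i => ?_
    by_cases hi : i ∈ Finset.range (m + 1)
    · simp only [ext, hi, dite_true]
      fun_prop
    · simp only [ext, hi, dite_false]
      fun_prop
  have hFext : ∀ x : ℕ → ℝ, F (ext fun i => x i) = F x := by
    refine fun x => hdep fun i hi => ?_
    have him : i < m + 1 := Nat.lt_succ_of_le hi
    exact dif_pos (Finset.mem_range.2 him)
  have hind := ((iIndepFun_coord p).indepFun_finset (Finset.range (m + 1)) {m + 1} (by simp)
    (fun i => measurable_pi_apply i)).comp (hF.comp hext)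
    (measurable_pi_apply (⟨m + 1, by simp⟩ : ({m + 1} : Finset ℕ)))
  have h := hind.integral_fun_mul_eq_mul_integral
    ((hF.comp hext).comp (by fun_prop)).aestronglyMeasurable
    (Measurable.comp (by fun_prop) (by fun_prop)).aestronglyMeasurable
  simp only [Function.comp_def, hFext] at h
  rw [h, integral_coord]

lemma chainSum_succ (m : ℕ) (x : ℕ → ℝ) : chainSum (m + 1) x = chainSum m x + x m * x (m + 1) :=
  Finset.sum_range_succ _ _

lemma chainSum_congr {m : ℕ} {x y : ℕ → ℝ} (h : ∀ i ∈ Set.Iic m, x i = y i) :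
    chainSum m x = chainSum m y :=
  Finset.sum_congr rfl fun j hj => by
    have := Finset.mem_range.1 hj
    rw [h j (by simp; omega), h (j + 1) (by simp; omega)]

/-- The two moments `E[e^{t X_m}]` and `E[e^{t X_m} x_m]` of a chain evolve linearly, because
`e^{t ε} = cosh t + ε sinh t` for a sign `ε`. -/
lemma mgf_chainSum_succ (t : ℝ) (m : ℕ) :
    mgf (chainSum (m + 1)) (configLaw p) t = Real.cosh t * mgf (chainSum m) (configLaw p) t +
        Real.sinh t * (2 * (p : ℝ) - 1) * ∫ x, Real.exp (t * chainSum m x) * x m ∂configLaw p ∧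
      ∫ x, Real.exp (t * chainSum (m + 1) x) * x (m + 1) ∂configLaw p =
        (2 * (p : ℝ) - 1) * Real.cosh t * mgf (chainSum m) (configLaw p) t +
        Real.sinh t * ∫ x, Real.exp (t * chainSum m x) * x m ∂configLaw p := by
  have hmE : Measurable fun x => Real.exp (t * chainSum m x) :=
    ((measurable_chainSum m).const_mul t).exp
  have hmC : Measurable fun x : ℕ → ℝ => Real.exp (t * chainSum m x) * x m :=
    hmE.mul (measurable_pi_apply m)
  have hb : ∀ᵐ x ∂configLaw p, |Real.exp (t * chainSum m x)| ≤ Real.exp (|t| * m) := by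
    filter_upwards [ae_abs_chainSum_le p m] with x hx
    rw [Real.abs_exp, Real.exp_le_exp]
    refine (le_abs_self _).trans ?_
    rw [abs_mul]
    gcongr
  have hi : ∀ G : (ℕ → ℝ) → ℝ, Measurable G → (∀ᵐ x ∂configLaw p, |G x| ≤ 1) →
      Integrable (fun x => Real.exp (t * chainSum m x) * G x) (configLaw p) := by
    intro G hG hG1
    refine Integrable.of_bound (hmE.mul hG).aestronglyMeasurable (Real.exp (|t| * m)) ?_
    filter_upwards [hb, hG1] with x h1 h2
    rw [Real.norm_eq_abs, abs_mul]
    calc _ ≤ Real.exp (|t| * m) * 1 := by gcongr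
      _ = _ := mul_one _
  have h1 : ∀ i, ∀ᵐ x ∂configLaw p, |x i| ≤ 1 := fun i => by
    filter_upwards [ae_coord p] with x hx
    rcases hx i with h | h <;> simp [h]
  have hE := hi (fun _ => 1) measurable_const (by simp)
  simp only [mul_one] at hE
  have hC := hi (fun x => x m) (measurable_pi_apply m) (h1 m)
  have hD := hi (fun x => x (m + 1)) (measurable_pi_apply _) (h1 _)
  have hCD := hi (fun x => x m * x (m + 1)) (by fun_prop) (by
    filter_upwards [h1 m, h1 (m + 1)] with x a b
    rw [abs_mul]
    exact mul_le_one₀ a (abs_nonneg _) b)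
  simp only [← mul_assoc] at hCD
  have hdE : DependsOn (fun x => Real.exp (t * chainSum m x)) (Set.Iic m) := fun x y hxy => by
    simp only [chainSum_congr hxy]
  have hdC : DependsOn (fun x : ℕ → ℝ => Real.exp (t * chainSum m x) * x m) (Set.Iic m) :=
    fun x y hxy => by simp only [chainSum_congr hxy, hxy m (Set.mem_Iic.2 le_rfl)]
  have hexp : ∀ ε : ℝ, ε = 1 ∨ ε = -1 → Real.exp (t * ε) = Real.cosh t + ε * Real.sinh t := by
    rintro ε (rfl | rfl)
    · simp [Real.cosh_add_sinh]
    · simp [← Real.cosh_sub_sinh, sub_eq_add_neg]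
  have hsign : ∀ a b : ℝ, (a = 1 ∨ a = -1) → (b = 1 ∨ b = -1) → (a * b = 1 ∨ a * b = -1) := by
    rintro a b (rfl | rfl) (rfl | rfl) <;> simp
  constructor
  · have e : ∀ᵐ x ∂configLaw p, Real.exp (t * chainSum (m + 1) x) =
        Real.cosh t * Real.exp (t * chainSum m x) +
          Real.sinh t * (Real.exp (t * chainSum m x) * x m * x (m + 1)) := by
      filter_upwards [ae_coord p] with x hx
      rw [chainSum_succ, mul_add, Real.exp_add, hexp _ (hsign _ _ (hx m) (hx (m + 1)))]
      ring
    rw [mgf, integral_congr_ae e, integral_add (hE.const_mul _)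
      (hCD.const_mul _), integral_const_mul, integral_const_mul,
      integral_mul_coord p hmC hdC, mgf]
    ring
  · have e : ∀ᵐ x ∂configLaw p, Real.exp (t * chainSum (m + 1) x) * x (m + 1) =
        Real.cosh t * (Real.exp (t * chainSum m x) * x (m + 1)) +
          Real.sinh t * (Real.exp (t * chainSum m x) * x m) := by
      filter_upwards [ae_coord p] with x hx
      rw [chainSum_succ, mul_add, Real.exp_add, hexp _ (hsign _ _ (hx m) (hx (m + 1)))]
      have : x (m + 1) * x (m + 1) = 1 := by rcases hx (m + 1) with h | h <;> simp [h]
      linear_combination Real.exp (t * chainSum m x) * x m * Real.sinh t * this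
    rw [integral_congr_ae e, integral_add (hD.const_mul _) (hC.const_mul _), integral_const_mul,
      integral_const_mul, integral_mul_coord p hmE hdE, mgf]
    ring

/-- The weights of a spin are `s e^{± h}` with `s = √(p (1 - p))`. -/
lemma sqrt_mul_exp_field {q : ℝ} (h0 : 0 < q) (h1 : q < 1) :
    √(q * (1 - q)) * Real.exp (field q) = q ∧ √(q * (1 - q)) * Real.exp (-field q) = 1 - q := by
  have h1' : 0 < 1 - q := by linarith
  have hs : √(q * (1 - q)) = Real.exp (1 / 2 * (Real.log q + Real.log (1 - q))) := by
    rw [← Real.log_mul h0.ne' h1'.ne', mul_comm (1 / 2), Real.exp_mul,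
      Real.exp_log (by positivity), Real.sqrt_eq_rpow]
  rw [hs, field, Real.log_div h0.ne' h1'.ne', ← Real.exp_add, ← Real.exp_add]
  constructor
  · convert Real.exp_log h0 using 2
    ring
  · convert Real.exp_log h1' using 2
    ring

/-- The spins carry weights `s e^{± h}`, so `E[e^{t X_m}] = s^{m+1} vᵀ Mᵐ v`; its logarithm is read off
from the spectral decomposition of `M`. The positivity of the argument of the logarithm in
`seriesTerm` comes from that of the moment generating function. -/
lemma cgf_chainSum (hp0 : 0 < p) (hp1 : p < 1) (t : ℝ) (m : ℕ) :
    cgf (chainSum m) (configLaw p) t = (m + 1) * Real.log √((p : ℝ) * (1 - p)) +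
      2 * Real.log (overlap (field p) t) + m * Real.log (eigPlus (field p) t) +
      2 ^ m * seriesTerm (field p) t m := by
  have h0 : (0 : ℝ) < p := hp0
  have h1 : (p : ℝ) < 1 := hp1
  obtain ⟨hH, hK⟩ := sqrt_mul_exp_field h0 h1
  have hpq : 0 < (p : ℝ) * (1 - p) := mul_pos h0 (by linarith)
  have hs : 0 < √((p : ℝ) * (1 - p)) := Real.sqrt_pos.2 hpq
  have hs2 := Real.sq_sqrt hpq.le
  have hc : √((p : ℝ) * (1 - p)) * (2 * Real.cosh (field p)) = 1 := by
    rw [Real.cosh_eq]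
    linear_combination hH + hK
  refine log_eq_of_pos _ _ hs (mgf_pos (integrable_exp_mul_of_abs_le
    (measurable_chainSum m).aemeasurable (ae_abs_chainSum_le p m) t)) ?_
  have hchain0 : chainSum 0 = fun _ => 0 := by
    funext x
    simp [chainSum]
  have hZ0 : mgf (chainSum 0) (configLaw p) t = 1 := by simp [hchain0]
  have hC0 : ∫ x, Real.exp (t * chainSum 0 x) * x 0 ∂configLaw p = 2 * (p : ℝ) - 1 := by
    simp [hchain0, integral_coord]
  refine eq_of_recurrence _ _ hc (Z := fun m => mgf (chainSum m) (configLaw p) t) hZ0 ?_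
    (fun m => ?_) m
  · rw [(mgf_chainSum_succ p t 0).1, hZ0, hC0, Real.cosh_eq, Real.sinh_eq]
    generalize √((p : ℝ) * (1 - p)) = s at *
    generalize Real.exp (field p) = H at *
    generalize Real.exp (-field p) = K at *
    linear_combination (-Real.exp t * (s * H + p)) * hH - Real.exp t * (s * K + (1 - p)) * hK
      - 2 * Real.exp (-t) * hs2
  · rw [(mgf_chainSum_succ p t (m + 1)).1, (mgf_chainSum_succ p t m).2, eigPlus_add_eigMinus,
      eigPlus_mul_eigMinus, hs2]
    have hZ := (mgf_chainSum_succ p t m).1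
    generalize mgf (chainSum m) (configLaw p) t = Z at *
    generalize mgf (chainSum (m + 1)) (configLaw p) t = Z' at *
    generalize (∫ x, Real.exp (t * chainSum m x) * x m ∂configLaw p) = C at *
    rw [Real.cosh_eq t, Real.sinh_eq t] at *
    generalize √((p : ℝ) * (1 - p)) = s at *
    linear_combination (-Real.exp t * Z') * hc - (Real.exp t - Real.exp (-t)) / 2 * hZ

end ConfigLaw

/-! ### Independence of the chains -/

section Chains

variable {Ω : Type*} [MeasurableSpace Ω] {μ : Measure Ω} [IsProbabilityMeasure μ]
  {p : unitInterval} {σ : ℕ → Ω → ℝ}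

/-- The chains starting at the different odd numbers are independent, and each of them is a sequence
of independent spins. -/
lemma chains_iIndepFun_and_hasLaw (hindep : iIndepFun σ μ)
    (hlaw : ∀ i, HasLaw (σ i) (bernoulliMeasure (1 : ℝ) (-1) p) μ) :
    iIndepFun (fun (a : ℕ) ω (j : ℕ) => σ (2 ^ j * (2 * a + 1)) ω) μ ∧
      ∀ a : ℕ, HasLaw (fun ω (j : ℕ) => σ (2 ^ j * (2 * a + 1)) ω) (configLaw p) μ := by
  have hσ : HasLaw (fun ω i => σ i ω) (configLaw p) μ :=
    hindep.hasLaw_infinitePi hlaw (aemeasurable_pi_iff.2 fun i => (hlaw i).aemeasurable)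
  have hre : HasLaw (fun (x : ℕ → ℝ) (q : ℕ × ℕ) => x (2 ^ q.2 * (2 * q.1 + 1)))
      (Measure.infinitePi fun _ : ℕ × ℕ => bernoulliMeasure (1 : ℝ) (-1) p) (configLaw p) :=
    ⟨Measurable.aemeasurable (by fun_prop),
      Measure.map_infinitePi_infinitePi_of_inj
        (P := fun _ : ℕ => bernoulliMeasure (1 : ℝ) (-1) p) two_pow_mul_odd_injective⟩
  have hcurry : HasLaw (MeasurableEquiv.curry ℕ ℕ ℝ)
      (Measure.infinitePi fun _ : ℕ => configLaw p)
      (Measure.infinitePi fun _ : ℕ × ℕ => bernoulliMeasure (1 : ℝ) (-1) p) :=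
    ⟨(MeasurableEquiv.measurable _).aemeasurable,
      Measure.infinitePi_map_curry fun _ _ : ℕ => bernoulliMeasure (1 : ℝ) (-1) p⟩
  have hall : HasLaw (fun ω (a j : ℕ) => σ (2 ^ j * (2 * a + 1)) ω)
      (Measure.infinitePi fun _ : ℕ => configLaw p) μ := hcurry.comp (hre.comp hσ)
  have hone : ∀ a : ℕ, HasLaw (fun ω (j : ℕ) => σ (2 ^ j * (2 * a + 1)) ω) (configLaw p) μ :=
    fun a => (measurePreserving_eval_infinitePi (fun _ : ℕ => configLaw p) a).hasLaw.comp hall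
  exact ⟨(iIndepFun_iff_hasLaw_Pi_infinitePi hone hall.aemeasurable).2 hall, hone⟩

lemma log_integral_exp_sumS (hindep : iIndepFun σ μ)
    (hlaw : ∀ i, HasLaw (σ i) (bernoulliMeasure (1 : ℝ) (-1) p) μ) (t : ℝ) (N : ℕ) :
    Real.log (∫ ω, Real.exp (t * sumS σ N ω) ∂μ) =
      ∑ a ∈ Finset.range N, cgf (chainSum (chainLength N a)) (configLaw p) t := by
  obtain ⟨hI, hL⟩ := chains_iIndepFun_and_hasLaw hindep hlaw
  have hIc := hI.comp (fun a => chainSum (chainLength N a)) fun a => measurable_chainSum _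
  have hm : ∀ a, AEMeasurable (chainSum (chainLength N a) ∘
      fun ω (j : ℕ) => σ (2 ^ j * (2 * a + 1)) ω) μ := fun a =>
    (measurable_chainSum _).comp_aemeasurable (hL a).aemeasurable
  have hmgf : ∀ a, mgf (chainSum (chainLength N a) ∘ fun ω (j : ℕ) => σ (2 ^ j * (2 * a + 1)) ω) μ t
      = mgf (chainSum (chainLength N a)) (configLaw p) t := fun a =>
    (hL a).integral_comp (f := fun x => Real.exp (t * chainSum (chainLength N a) x))
      ((measurable_chainSum _).const_mul t).exp.aestronglyMeasurable
  have hprod := hIc.mgf_sum₀ hm (t := t) (Finset.range N)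
  simp only [hmgf] at hprod
  have : ∫ ω, Real.exp (t * sumS σ N ω) ∂μ =
      ∏ a ∈ Finset.range N, mgf (chainSum (chainLength N a)) (configLaw p) t := by
    rw [← hprod, mgf]
    refine integral_congr_ae (Eventually.of_forall fun ω => ?_)
    simp only [sumS_eq_sum_chainSum, Finset.sum_apply, Function.comp_apply]
  rw [this, Real.log_prod fun a _ => (mgf_pos (integrable_exp_mul_of_abs_le
    (measurable_chainSum _).aemeasurable (ae_abs_chainSum_le p _) t)).ne']
  rfl

end Chains

/-! ### The free energy as a series of cumulant generating functions -/

section FreeEnergy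

variable {p : unitInterval}

lemma chainSum_zero : chainSum 0 = 0 := by
  funext x
  simp [chainSum]

lemma abs_cgf_chainSum_le (p : unitInterval) (t : ℝ) (m : ℕ) :
    |cgf (chainSum m) (configLaw p) t| ≤ |t| * (m : ℝ) ^ 1 := by
  rw [pow_one]
  exact abs_cgf_le (measurable_chainSum m).aemeasurable (ae_abs_chainSum_le p m) t

lemma summable_seriesTerm_and_freeEnergy_eq (hp0 : 0 < p) (hp1 : p < 1) (t : ℝ) :
    Summable (fun n : ℕ => seriesTerm (field p) t (n + 1)) ∧
      freeEnergy p t = ∑' m : ℕ, cgf (chainSum (m + 1)) (configLaw p) t / 2 ^ (m + 2) := by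
  have h0 : (0 : ℝ) < p := hp0
  have h1 : (p : ℝ) < 1 := hp1
  have hpq : 0 < (p : ℝ) * (1 - p) := mul_pos h0 (by linarith)
  have hc := (summable_div_two_pow_of_le (abs_cgf_chainSum_le p t)).hasSum
  have hg1 : HasSum (fun m : ℕ => (1 / 2 : ℝ) ^ (m + 1)) 1 := by
    have := (hasSum_geometric_of_lt_one (r := (1 / 2 : ℝ)) (by norm_num) (by norm_num)).mul_left
      (1 / 2)
    simp only [← pow_succ'] at this
    rwa [show (1 / 2 : ℝ) * (1 - 1 / 2)⁻¹ = 1 by norm_num] at this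
  have hg2 : HasSum (fun m : ℕ => ((m : ℝ) + 1) * (1 / 2 : ℝ) ^ (m + 1)) 2 := by
    have := hasSum_coe_mul_geometric_of_norm_lt_one (𝕜 := ℝ) (r := 1 / 2) (by norm_num)
    rw [← hasSum_nat_add_iff' 1] at this
    norm_num at this
    convert this using 2 with m
  set ls := Real.log √((p : ℝ) * (1 - p)) with hls
  set lo := Real.log (overlap (field p) t) with hlo
  set lL := Real.log (eigPlus (field p) t) with hlL
  have hS : HasSum (fun n : ℕ => seriesTerm (field p) t (n + 1))
      (2 * (∑' m : ℕ, cgf (chainSum (m + 1)) (configLaw p) t / 2 ^ (m + 2)) -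
        ((ls + lL) * 2 + (ls + 2 * lo) * 1)) := by
    refine ((hc.mul_left 2).sub ((hg2.mul_left (ls + lL)).add (hg1.mul_left (ls + 2 * lo)))).congr_fun
      fun n => ?_
    rw [cgf_chainSum p hp0 hp1 t (n + 1), pow_succ _ (n + 1), one_div, inv_pow]
    push_cast
    field_simp
    ring
  refine ⟨hS.summable, ?_⟩
  rw [freeEnergy, hS.tsum_eq, Real.log_mul (mul_pos (by positivity) (overlap_pos _ _)).ne'
    (eigPlus_pos _ _).ne', Real.log_mul (by positivity) (overlap_pos _ _).ne',
    Real.log_rpow hpq, ← hlo, ← hlL]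
  rw [Real.log_sqrt hpq.le] at hls
  rw [hls]
  ring

lemma tendsto_log_integral_exp_sumS {Ω : Type*} [MeasurableSpace Ω] {μ : Measure Ω}
    [IsProbabilityMeasure μ] {σ : ℕ → Ω → ℝ} (hp0 : 0 < p) (hp1 : p < 1) (hindep : iIndepFun σ μ)
    (hlaw : ∀ i, HasLaw (σ i) (bernoulliMeasure (1 : ℝ) (-1) p) μ) (t : ℝ) :
    Tendsto (fun N : ℕ => 1 / (N : ℝ) * Real.log (∫ ω, Real.exp (t * sumS σ N ω) ∂μ))
      atTop (𝓝 (freeEnergy p t)) := by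
  simp_rw [log_integral_exp_sumS hindep hlaw]
  rw [(summable_seriesTerm_and_freeEnergy_eq hp0 hp1 t).2]
  exact tendsto_average_chainLength (f := fun m => cgf (chainSum m) (configLaw p) t)
    (by simp [chainSum_zero]) (abs_cgf_chainSum_le p t)

lemma variance_chainSum_le (p : unitInterval) (m : ℕ) :
    |Var[chainSum m; configLaw p]| ≤ 1 * (m : ℝ) ^ 2 := by
  rw [abs_of_nonneg (variance_nonneg _ _), one_mul]
  exact variance_le_of_abs_le (measurable_chainSum m).aemeasurable (ae_abs_chainSum_le p m)

lemma contDiff_freeEnergy_and_iteratedDeriv_two (hp0 : 0 < p) (hp1 : p < 1) :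
    ContDiff ℝ 2 (freeEnergy p) ∧ iteratedDeriv 2 (freeEnergy p) 0 =
      ∑' m : ℕ, Var[chainSum (m + 1); configLaw p] / 2 ^ (m + 2) := by
  have hF : freeEnergy p =
      fun t => ∑' m : ℕ, cgf (chainSum (m + 1)) (configLaw p) t / 2 ^ (m + 2) :=
    funext fun t => (summable_seriesTerm_and_freeEnergy_eq hp0 hp1 t).2
  have hX : ∀ m, AEMeasurable (chainSum m) (configLaw p) := fun m =>
    (measurable_chainSum m).aemeasurable
  have hB := ae_abs_chainSum_le p
  have hdd : ∀ (m : ℕ) (t : ℝ),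
      iteratedDeriv 2 (fun t => cgf (chainSum (m + 1)) (configLaw p) t / 2 ^ (m + 2)) t =
        iteratedDeriv 2 (cgf (chainSum (m + 1)) (configLaw p)) t / 2 ^ (m + 2) := fun m t =>
    iteratedDeriv_div_const _ _
  have hu : Summable fun m : ℕ => ((m + 1 : ℕ) : ℝ) / 2 ^ (m + 2) :=
    summable_div_two_pow_of_le (f := fun m => (m : ℝ)) (C := 1) (d := 1) (by simp)
  have hv : Summable fun m : ℕ => ((m + 1 : ℕ) : ℝ) ^ 2 / 2 ^ (m + 2) :=
    summable_div_two_pow_of_le (f := fun m => (m : ℝ) ^ 2) (C := 1) (d := 2) (by simp)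
  have hgu : ∀ (m : ℕ) (t : ℝ),
      |deriv (fun t => cgf (chainSum (m + 1)) (configLaw p) t / 2 ^ (m + 2)) t| ≤
        ((m + 1 : ℕ) : ℝ) / 2 ^ (m + 2) := fun m t => by
    rw [deriv_div_const, abs_div, abs_of_pos (by positivity : (0 : ℝ) < 2 ^ (m + 2))]
    exact div_le_div_of_nonneg_right (abs_deriv_cgf_le (hX _) (hB _) t) (by positivity)
  have hgv : ∀ (m : ℕ) (t : ℝ),
      |iteratedDeriv 2 (fun t => cgf (chainSum (m + 1)) (configLaw p) t / 2 ^ (m + 2)) t| ≤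
        ((m + 1 : ℕ) : ℝ) ^ 2 / 2 ^ (m + 2) := fun m t => by
    rw [hdd, abs_div, abs_of_pos (by positivity : (0 : ℝ) < 2 ^ (m + 2))]
    exact div_le_div_of_nonneg_right (abs_iteratedDeriv_two_cgf_le (hX _) (hB _) t) (by positivity)
  have hcd : ∀ m : ℕ,
      ContDiff ℝ 2 fun t => cgf (chainSum (m + 1)) (configLaw p) t / 2 ^ (m + 2) := fun m =>
    (contDiff_cgf (hX _) (hB _)).div_const _
  have hs0 : Summable fun m : ℕ => cgf (chainSum (m + 1)) (configLaw p) 0 / 2 ^ (m + 2) :=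
    summable_div_two_pow_of_le (f := fun m => cgf (chainSum m) (configLaw p) 0)
      (abs_cgf_chainSum_le p 0)
  obtain ⟨hcont, hder⟩ := contDiff_two_tsum hcd hu hv hgu hgv hs0
  rw [hF]
  refine ⟨hcont, (hder 0).trans (tsum_congr fun m => ?_)⟩
  rw [hdd, iteratedDeriv_two_cgf_zero (hX _) (hB _)]

lemma variance_chainSum_one_pos (hp0 : 0 < p) (hp1 : p < 1) :
    0 < Var[chainSum 1; configLaw p] := by
  have h0 : (0 : ℝ) < p := hp0
  have h1 : (p : ℝ) < 1 := hp1
  have hc : chainSum 1 = fun x => x 0 * x (0 + 1) := by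
    funext x
    simp [chainSum]
  have hmean : ∫ x, chainSum 1 x ∂configLaw p = (2 * (p : ℝ) - 1) * (2 * p - 1) := by
    rw [hc, integral_mul_coord p (F := fun x => x 0) (measurable_pi_apply 0)
      (fun x y h => h 0 (by simp)), integral_coord]
  have hsq : ∫ x, (chainSum 1 ^ 2) x ∂configLaw p = 1 := by
    have : ∀ᵐ x ∂configLaw p, (chainSum 1 ^ 2) x = 1 := by
      filter_upwards [ae_coord p] with x hx
      rw [hc]
      rcases hx 0 with h | h <;> rcases hx (0 + 1) with h' | h' <;> simp [h, h']
    rw [integral_congr_ae this]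
    simp
  rw [variance_eq_sub (MemLp.of_bound (measurable_chainSum 1).aestronglyMeasurable _
    (ae_abs_chainSum_le p 1)), hsq, hmean]
  have hq : (2 * (p : ℝ) - 1) * (2 * p - 1) < 1 := by nlinarith
  have hq0 : 0 ≤ (2 * (p : ℝ) - 1) * (2 * p - 1) := mul_self_nonneg _
  nlinarith

lemma iteratedDeriv_two_freeEnergy_pos (hp0 : 0 < p) (hp1 : p < 1) :
    0 < iteratedDeriv 2 (freeEnergy p) 0 := by
  rw [(contDiff_freeEnergy_and_iteratedDeriv_two hp0 hp1).2]
  exact (summable_div_two_pow_of_le (variance_chainSum_le p)).tsum_pos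
    (fun m => div_nonneg (variance_nonneg _ _) (by positivity)) 0
    (div_pos (variance_chainSum_one_pos hp0 hp1) (by positivity))

end FreeEnergy

/-! ### Convergence of the characteristic functions -/

lemma norm_exp_mul_I_sub_le (θ : ℝ) :
    ‖Complex.exp (θ * Complex.I) - (1 + θ * Complex.I - (θ : ℂ) ^ 2 / 2)‖ ≤ 4 * |θ| ^ 3 := by
  have hn : ‖(θ : ℂ) * Complex.I‖ = |θ| := by simp
  have hI : ((θ : ℂ) * Complex.I) ^ 2 = -(θ : ℂ) ^ 2 := by rw [mul_pow, Complex.I_sq]; ring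
  rcases le_total |θ| 1 with h | h
  · have := Complex.exp_bound (x := θ * Complex.I) (by rwa [hn]) (n := 3) (by norm_num)
    rw [hn] at this
    norm_num [Finset.sum_range_succ, Nat.factorial, hI] at this
    rw [show (1 + (θ : ℂ) * Complex.I - (θ : ℂ) ^ 2 / 2)
      = 1 + θ * Complex.I + -(θ : ℂ) ^ 2 / 2 by ring]
    refine this.trans ?_
    have : 0 ≤ |θ| ^ 3 := by positivity
    linarith
  -- for `1 ≤ |θ|` every term is at most `|θ| ^ 3`
  · have h1 : ‖Complex.exp (θ * Complex.I)‖ = 1 := Complex.norm_exp_ofReal_mul_I θ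
    have h2 : ‖(1 : ℂ) + θ * Complex.I - (θ : ℂ) ^ 2 / 2‖ ≤ 1 + |θ| + |θ| ^ 2 / 2 := by
      refine (norm_sub_le _ _).trans (add_le_add ((norm_add_le _ _).trans ?_) ?_)
      · simp
      · simp
    have h3 := norm_sub_le (Complex.exp (θ * Complex.I)) (1 + θ * Complex.I - (θ : ℂ) ^ 2 / 2)
    have h4 : |θ| ^ 2 ≤ |θ| ^ 3 := pow_le_pow_right₀ h (by norm_num)
    have h5 : |θ| ≤ |θ| ^ 2 := le_self_pow₀ h (by norm_num)
    linarith

/-- Second order expansion of the characteristic function of a bounded centred random variable, with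
an explicit third order remainder. -/
lemma norm_charFun_sub_le {α : Type*} [MeasurableSpace α] {ν : Measure α} [IsProbabilityMeasure ν]
    {Y : α → ℝ} {B : ℝ} (hY : AEMeasurable Y ν) (hB : ∀ᵐ x ∂ν, |Y x| ≤ B) (h0 : ∫ x, Y x ∂ν = 0)
    (u : ℝ) :
    ‖charFun (ν.map Y) u - ((1 - Var[Y; ν] * u ^ 2 / 2 : ℝ) : ℂ)‖ ≤ 4 * (|u| * B) ^ 3 := by
  have hi : ∀ n : ℕ, Integrable (fun x => Y x ^ n) ν := fun n =>
    Integrable.of_bound (hY.pow_const n).aestronglyMeasurable (B ^ n) (by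
      filter_upwards [hB] with x hx
      rw [norm_pow, Real.norm_eq_abs]
      gcongr)
  have hexp : Integrable (fun x => Complex.exp (((u * Y x : ℝ) : ℂ) * Complex.I)) ν :=
    Integrable.of_bound (by fun_prop) 1
      (Eventually.of_forall fun x => (Complex.norm_exp_ofReal_mul_I _).le)
  have h1 : Integrable (fun x => ((u * Y x : ℝ) : ℂ) * Complex.I) ν :=
    (((hi 1).congr (by simp)).const_mul u).ofReal.mul_const _
  have h2 : Integrable (fun x => ((u * Y x : ℝ) : ℂ) ^ 2 / 2) ν := by
    have : Integrable (fun x => ((u ^ 2 / 2 * Y x ^ 2 : ℝ) : ℂ)) ν :=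
      ((hi 2).const_mul (u ^ 2 / 2)).ofReal
    refine this.congr (Eventually.of_forall fun x => ?_)
    simp only
    push_cast
    ring
  have h3 : Integrable (fun x => 1 + ((u * Y x : ℝ) : ℂ) * Complex.I) ν :=
    (integrable_const _).add h1
  have h4 : Integrable (fun x => 1 + ((u * Y x : ℝ) : ℂ) * Complex.I -
      ((u * Y x : ℝ) : ℂ) ^ 2 / 2) ν := h3.sub h2
  have hpoly : ∫ x, (1 + ((u * Y x : ℝ) : ℂ) * Complex.I - ((u * Y x : ℝ) : ℂ) ^ 2 / 2) ∂ν =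
      ((1 - Var[Y; ν] * u ^ 2 / 2 : ℝ) : ℂ) := by
    rw [integral_sub h3 h2, integral_add (integrable_const _) h1,
      integral_mul_const, integral_complex_ofReal, integral_const_mul, h0, variance_eq_integral hY, h0]
    have : ∀ x, ((u * Y x : ℝ) : ℂ) ^ 2 / 2 = ((u ^ 2 / 2 * Y x ^ 2 : ℝ) : ℂ) := fun x => by
      push_cast
      ring
    simp_rw [this, integral_complex_ofReal, integral_const_mul]
    simp
    ring
  have hchar : charFun (ν.map Y) u = ∫ x, Complex.exp (((u * Y x : ℝ) : ℂ) * Complex.I) ∂ν := by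
    rw [charFun_apply_real, integral_map hY (by fun_prop)]
    simp
  rw [hchar, ← hpoly, ← integral_sub hexp h4]
  have := norm_integral_le_of_norm_le_const (μ := ν) (C := 4 * (|u| * B) ^ 3)
    (f := fun x => Complex.exp (((u * Y x : ℝ) : ℂ) * Complex.I) -
      (1 + ((u * Y x : ℝ) : ℂ) * Complex.I - ((u * Y x : ℝ) : ℂ) ^ 2 / 2)) (by
    filter_upwards [hB] with x hx
    refine (norm_exp_mul_I_sub_le _).trans ?_
    rw [abs_mul]
    gcongr)
  simpa using this

lemma abs_one_sub_sub_exp_neg_le {x : ℝ} (hx : 0 ≤ x) : |1 - x - Real.exp (-x)| ≤ x ^ 2 := by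
  have h1 := Real.one_sub_le_exp_neg x
  have h2 : Real.exp (-x) ≤ 1 - x + x ^ 2 := by
    have h3 : Real.exp (-x) ≤ 1 / (1 + x) := by
      rw [Real.exp_neg, ← one_div]
      exact one_div_le_one_div_of_le (by linarith) (by linarith [Real.add_one_le_exp x])
    refine h3.trans ?_
    rw [div_le_iff₀ (by linarith)]
    nlinarith [pow_nonneg hx 3]
  rw [abs_le]
  constructor <;> linarith

lemma norm_prod_sub_prod_le {ι : Type*} (s : Finset ι) {f g : ι → ℂ} (hf : ∀ i, ‖f i‖ ≤ 1)
    (hg : ∀ i, ‖g i‖ ≤ 1) : ‖∏ i ∈ s, f i - ∏ i ∈ s, g i‖ ≤ ∑ i ∈ s, ‖f i - g i‖ := by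
  classical
  induction s using Finset.induction_on with
  | empty => simp
  | insert a s ha ih =>
    rw [Finset.prod_insert ha, Finset.prod_insert ha, Finset.sum_insert ha]
    have hp : ‖∏ i ∈ s, f i‖ ≤ 1 := by
      rw [norm_prod]
      exact Finset.prod_le_one (fun _ _ => norm_nonneg _) fun i _ => hf i
    calc ‖f a * ∏ i ∈ s, f i - g a * ∏ i ∈ s, g i‖
        = ‖(f a - g a) * ∏ i ∈ s, f i + g a * (∏ i ∈ s, f i - ∏ i ∈ s, g i)‖ := by
          congr 1
          ring
      _ ≤ ‖f a - g a‖ * ‖∏ i ∈ s, f i‖ + ‖g a‖ * ‖∏ i ∈ s, f i - ∏ i ∈ s, g i‖ := by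
          rw [← norm_mul, ← norm_mul]
          exact norm_add_le _ _
      _ ≤ ‖f a - g a‖ * 1 + 1 * ∑ i ∈ s, ‖f i - g i‖ := by
          gcongr
          exact hg a
      _ = _ := by ring

/-- The characteristic function of the centred sum over the first `m` bonds of a chain. -/
noncomputable def chainCharFun (p : unitInterval) (m : ℕ) (u : ℝ) : ℂ :=
  charFun ((configLaw p).map fun x => chainSum m x - ∫ y, chainSum m y ∂configLaw p) u

lemma norm_chainCharFun_le_one (p : unitInterval) (m : ℕ) (u : ℝ) : ‖chainCharFun p m u‖ ≤ 1 := by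
  have : IsProbabilityMeasure
      ((configLaw p).map fun x => chainSum m x - ∫ y, chainSum m y ∂configLaw p) :=
    Measure.isProbabilityMeasure_map ((measurable_chainSum m).sub_const _).aemeasurable
  exact norm_charFun_le_one _

lemma norm_chainCharFun_sub_le (p : unitInterval) (m : ℕ) (u : ℝ) :
    ‖chainCharFun p m u - Complex.exp ((-(Var[chainSum m; configLaw p] * u ^ 2 / 2) : ℝ) : ℂ)‖ ≤
      32 * |u| ^ 3 * (m : ℝ) ^ 3 + u ^ 4 * (m : ℝ) ^ 4 := by
  have hX := (measurable_chainSum m).aemeasurable (μ := configLaw p)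
  have hB := ae_abs_chainSum_le p m
  have hi : Integrable (chainSum m) (configLaw p) :=
    Integrable.of_bound hX.aestronglyMeasurable m hB
  have hmean : |∫ y, chainSum m y ∂configLaw p| ≤ m := by
    simpa using norm_integral_le_of_norm_le_const (μ := configLaw p) (f := chainSum m) (C := m) hB
  have h1 := norm_charFun_sub_le (B := 2 * m)
    (hX.sub_const (∫ y, chainSum m y ∂configLaw p)) (by
      filter_upwards [hB] with x hx
      exact (abs_sub _ _).trans (by linarith))
    (by rw [integral_sub hi (integrable_const _)]; simp) u
  rw [variance_sub_const hX.aestronglyMeasurable] at h1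
  set v := Var[chainSum m; configLaw p] with hv
  have hv0 : 0 ≤ v := variance_nonneg _ _
  have hvm : v ≤ (m : ℝ) ^ 2 := variance_le_of_abs_le hX hB
  have h2 := abs_one_sub_sub_exp_neg_le (x := v * u ^ 2 / 2) (by positivity)
  have h3 : ‖((1 - v * u ^ 2 / 2 : ℝ) : ℂ) - Complex.exp ((-(v * u ^ 2 / 2) : ℝ) : ℂ)‖ ≤
      (v * u ^ 2 / 2) ^ 2 := by
    rw [← Complex.ofReal_exp, ← Complex.ofReal_sub, Complex.norm_real]
    exact h2
  have h4 : (v * u ^ 2 / 2) ^ 2 ≤ u ^ 4 * (m : ℝ) ^ 4 := by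
    have : v ^ 2 ≤ ((m : ℝ) ^ 2) ^ 2 := by gcongr
    have hu : 0 ≤ u ^ 4 := by positivity
    have := mul_le_mul_of_nonneg_left this hu
    have h0 : 0 ≤ u ^ 4 * v ^ 2 := by positivity
    calc (v * u ^ 2 / 2) ^ 2 = u ^ 4 * v ^ 2 / 4 := by ring
      _ ≤ u ^ 4 * v ^ 2 := by linarith
      _ ≤ _ := by rw [← pow_mul] at this; exact this
  calc _ ≤ _ := norm_sub_le_norm_sub_add_norm_sub _ ((1 - v * u ^ 2 / 2 : ℝ) : ℂ) _
    _ ≤ 4 * (|u| * (2 * m)) ^ 3 + (v * u ^ 2 / 2) ^ 2 := add_le_add h1 h3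
    _ ≤ 4 * (|u| * (2 * m)) ^ 3 + u ^ 4 * (m : ℝ) ^ 4 := by gcongr
    _ = _ := by ring

lemma charFun_sumS {Ω : Type*} [MeasurableSpace Ω] {μ : Measure Ω}
    [IsProbabilityMeasure μ] {p : unitInterval} {σ : ℕ → Ω → ℝ} (hindep : iIndepFun σ μ)
    (hlaw : ∀ i, HasLaw (σ i) (bernoulliMeasure (1 : ℝ) (-1) p) μ) (N : ℕ) :
    AEMeasurable (fun ω => sumS σ N ω - ∫ ω', sumS σ N ω' ∂μ) μ ∧ ∀ u : ℝ,
      charFun (μ.map fun ω => sumS σ N ω - ∫ ω', sumS σ N ω' ∂μ) u =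
        ∏ a ∈ Finset.range N, chainCharFun p (chainLength N a) u := by
  obtain ⟨hI, hL⟩ := chains_iIndepFun_and_hasLaw hindep hlaw
  have hm : ∀ a, AEMeasurable (fun ω => chainSum (chainLength N a)
      (fun j : ℕ => σ (2 ^ j * (2 * a + 1)) ω)) μ := fun a =>
    (measurable_chainSum _).comp_aemeasurable (hL a).aemeasurable
  have hint : ∀ a, Integrable (fun ω => chainSum (chainLength N a)
      (fun j : ℕ => σ (2 ^ j * (2 * a + 1)) ω)) μ := fun a =>
    Integrable.of_bound (hm a).aestronglyMeasurable (chainLength N a)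
      (((hL a).ae_iff (measurableSet_setOfPred.1
        (measurableSet_le (measurable_chainSum _).norm measurable_const))).2
        (ae_abs_chainSum_le p (chainLength N a)))
  have hEa : ∀ a, ∫ ω, chainSum (chainLength N a) (fun j : ℕ => σ (2 ^ j * (2 * a + 1)) ω) ∂μ =
      ∫ y, chainSum (chainLength N a) y ∂configLaw p := fun a =>
    (hL a).integral_comp (measurable_chainSum _).aestronglyMeasurable
  have hsum : (fun ω => sumS σ N ω - ∫ ω', sumS σ N ω' ∂μ) = fun ω => ∑ a ∈ Finset.range N,
      (chainSum (chainLength N a) (fun j : ℕ => σ (2 ^ j * (2 * a + 1)) ω) -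
        ∫ y, chainSum (chainLength N a) y ∂configLaw p) := by
    funext ω
    simp_rw [sumS_eq_sum_chainSum]
    rw [integral_finsetSum _ fun a _ => hint a, Finset.sum_sub_distrib]
    simp_rw [hEa]
  have hIc := hI.comp (fun a x => chainSum (chainLength N a) x -
    ∫ y, chainSum (chainLength N a) y ∂configLaw p) fun a => (measurable_chainSum _).sub_const _
  rw [hsum]
  refine ⟨Finset.aemeasurable_fun_sum _ fun a _ => (hm a).sub_const _, fun u => ?_⟩
  have hprod := iIndepFun.charFun_map_fun_finsetSum_eq_prod (P := μ) (s := Finset.range N)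
    (fun a _ => (hm a).sub_const (∫ y, chainSum (chainLength N a) y ∂configLaw p))
    (hIc.restrict (Finset.range N))
  rw [hprod, Finset.prod_apply]
  refine Finset.prod_congr rfl fun a _ => ?_
  have hg : Measurable fun x => chainSum (chainLength N a) x -
      ∫ y, chainSum (chainLength N a) y ∂configLaw p := (measurable_chainSum _).sub_const _
  have hgL : HasLaw (fun x => chainSum (chainLength N a) x -
      ∫ y, chainSum (chainLength N a) y ∂configLaw p) ((configLaw p).map fun x =>
        chainSum (chainLength N a) x - ∫ y, chainSum (chainLength N a) y ∂configLaw p)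
      (configLaw p) := ⟨hg.aemeasurable, rfl⟩
  rw [chainCharFun, ← (hgL.comp (hL a)).map_eq]
  rfl

/-- The product of the characteristic functions of the chains is compared factor by factor with
Gaussian ones; the errors are averages of `m ^ 3` and `m ^ 4` over the chain lengths `m`, multiplied
by a negative power of `N`. -/
lemma tendsto_prod_chainCharFun (p : unitInterval) (s : ℝ) :
    Tendsto (fun N : ℕ => ∏ a ∈ Finset.range N, chainCharFun p (chainLength N a) ((√(N : ℝ))⁻¹ * s))
      atTop (𝓝 (Complex.exp ((-((∑' m : ℕ, Var[chainSum (m + 1); configLaw p] / 2 ^ (m + 2)) *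
        s ^ 2 / 2) : ℝ) : ℂ))) := by
  set V := ∑' m : ℕ, Var[chainSum (m + 1); configLaw p] / 2 ^ (m + 2) with hV
  have hgauss : Tendsto (fun N : ℕ => ∏ a ∈ Finset.range N,
      Complex.exp ((-(Var[chainSum (chainLength N a); configLaw p] *
        ((√(N : ℝ))⁻¹ * s) ^ 2 / 2) : ℝ) : ℂ)) atTop
      (𝓝 (Complex.exp ((-(V * s ^ 2 / 2) : ℝ) : ℂ))) := by
    have havg := tendsto_average_chainLength (f := fun m => Var[chainSum m; configLaw p])
      (by simp [chainSum_zero]) (variance_chainSum_le p)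
    have h1 := ((havg.mul_const (s ^ 2)).div_const 2).neg
    refine Tendsto.congr (fun N => ?_)
      ((Complex.continuous_exp.comp Complex.continuous_ofReal).continuousAt.tendsto.comp h1)
    simp only [Function.comp_apply]
    rw [← Complex.exp_sum, ← Complex.ofReal_sum]
    congr 2
    rw [Finset.sum_neg_distrib, ← Finset.sum_div, ← Finset.sum_mul, mul_pow, inv_pow,
      Real.sq_sqrt N.cast_nonneg]
    ring
  have hdiff : Tendsto (fun N : ℕ =>
      ∏ a ∈ Finset.range N, chainCharFun p (chainLength N a) ((√(N : ℝ))⁻¹ * s) -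
      ∏ a ∈ Finset.range N, Complex.exp ((-(Var[chainSum (chainLength N a); configLaw p] *
        ((√(N : ℝ))⁻¹ * s) ^ 2 / 2) : ℝ) : ℂ)) atTop (𝓝 0) := by
    have h3 := tendsto_average_chainLength (f := fun m => (m : ℝ) ^ 3) (C := 1) (d := 3) (by simp)
      (by simp)
    have h4 := tendsto_average_chainLength (f := fun m => (m : ℝ) ^ 4) (C := 1) (d := 4) (by simp)
      (by simp)
    have hr : Tendsto (fun N : ℕ => (√(N : ℝ))⁻¹) atTop (𝓝 0) :=
      tendsto_inv_atTop_zero.comp (Real.tendsto_sqrt_atTop.comp tendsto_natCast_atTop_atTop)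
    have hbound := ((hr.mul h3).const_mul (32 * |s| ^ 3)).add (((hr.pow 2).mul h4).const_mul (s ^ 4))
    simp only [zero_mul, mul_zero, add_zero, ne_eq, OfNat.ofNat_ne_zero, not_false_eq_true,
      zero_pow] at hbound
    refine squeeze_zero_norm (fun N => ?_) hbound
    refine (norm_prod_sub_prod_le _ (fun a => norm_chainCharFun_le_one p _ _) fun a => ?_).trans ?_
    · rw [← Complex.ofReal_exp, Complex.norm_real, Real.norm_eq_abs, Real.abs_exp,
        Real.exp_le_one_iff, neg_nonpos]
      have := variance_nonneg (chainSum (chainLength N a)) (configLaw p)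
      positivity
    · refine (Finset.sum_le_sum fun a _ => norm_chainCharFun_sub_le p _ _).trans (le_of_eq ?_)
      rw [Finset.sum_add_distrib, ← Finset.mul_sum, ← Finset.mul_sum, abs_mul,
        abs_of_nonneg (inv_nonneg.2 (Real.sqrt_nonneg _))]
      have hN : 1 / (N : ℝ) = (√(N : ℝ))⁻¹ ^ 2 := by
        rw [inv_pow, Real.sq_sqrt N.cast_nonneg, one_div]
      rw [hN]
      ring
  simpa using hdiff.add hgauss

lemma tendstoInDistribution_sumS {Ω : Type*} [MeasurableSpace Ω] {μ : Measure Ω}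
    [IsProbabilityMeasure μ] {p : unitInterval} {σ : ℕ → Ω → ℝ} (hindep : iIndepFun σ μ)
    (hlaw : ∀ i, HasLaw (σ i) (bernoulliMeasure (1 : ℝ) (-1) p) μ) :
    TendstoInDistribution
      (fun (N : ℕ) ω => (√(N : ℝ))⁻¹ * (sumS σ N ω - ∫ ω', sumS σ N ω' ∂μ))
      atTop (id : ℝ → ℝ) (fun _ => μ)
      (gaussianReal 0
        (∑' m : ℕ, Var[chainSum (m + 1); configLaw p] / 2 ^ (m + 2)).toNNReal) where
  forall_aemeasurable N := (charFun_sumS hindep hlaw N).1.const_mul _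
  tendsto := by
    refine ProbabilityMeasure.tendsto_iff_tendsto_charFun.2 fun s => ?_
    have hV : 0 ≤ ∑' m : ℕ, Var[chainSum (m + 1); configLaw p] / 2 ^ (m + 2) :=
      tsum_nonneg fun m => div_nonneg (variance_nonneg _ _) (by positivity)
    have hlim := tendsto_prod_chainCharFun p s
    simp only [ProbabilityMeasure.coe_mk, Measure.map_id, charFun_gaussianReal]
    have e1 : ∀ N : ℕ, charFun (μ.map fun ω => (√(N : ℝ))⁻¹ *
        (sumS σ N ω - ∫ ω', sumS σ N ω' ∂μ)) s =
        ∏ a ∈ Finset.range N, chainCharFun p (chainLength N a) ((√(N : ℝ))⁻¹ * s) := fun N => by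
      rw [charFun_map_mul_comp (charFun_sumS hindep hlaw N).1, (charFun_sumS hindep hlaw N).2]
    simp only [e1]
    convert hlim using 3
    rw [Real.coe_toNNReal _ hV]
    push_cast
    ring

end Nonconventional

theorem theorem1 {Ω : Type*} [MeasurableSpace Ω] (μ : Measure Ω) [IsProbabilityMeasure μ]
    (p : unitInterval) (hp0 : 0 < p) (hp1 : p < 1) (σ : ℕ → Ω → ℝ)
    (hindep : iIndepFun σ μ) (hlaw : ∀ i, HasLaw (σ i) (bernoulliMeasure (1 : ℝ) (-1) p) μ) :
    (∀ t : ℝ, Summable (fun n : ℕ => Nonconventional.seriesTerm (Nonconventional.field p) t (n + 1)) ∧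
      Tendsto
        (fun N : ℕ => 1 / (N : ℝ) * Real.log (∫ ω, Real.exp (t * Nonconventional.sumS σ N ω) ∂μ))
        atTop (𝓝 (Nonconventional.freeEnergy p t))) ∧
    ContDiffAt ℝ 2 (Nonconventional.freeEnergy p) 0 ∧
    0 < iteratedDeriv 2 (Nonconventional.freeEnergy p) 0 ∧
    TendstoInDistribution
      (fun (N : ℕ) ω =>
        (√(N : ℝ))⁻¹ * (Nonconventional.sumS σ N ω - ∫ ω', Nonconventional.sumS σ N ω' ∂μ))
      atTop (id : ℝ → ℝ) (fun _ => μ)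
      (gaussianReal 0 (iteratedDeriv 2 (Nonconventional.freeEnergy p) 0).toNNReal) := by
  have hF := Nonconventional.contDiff_freeEnergy_and_iteratedDeriv_two hp0 hp1
  refine ⟨fun t => ⟨(Nonconventional.summable_seriesTerm_and_freeEnergy_eq hp0 hp1 t).1,
    Nonconventional.tendsto_log_integral_exp_sumS hp0 hp1 hindep hlaw t⟩, hF.1.contDiffAt,
    Nonconventional.iteratedDeriv_two_freeEnergy_pos hp0 hp1, ?_⟩
  rw [hF.2]
  exact Nonconventional.tendstoInDistribution_sumS hindep hlaw
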